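/- For a finite string $w$, the LZ-End factorization of $w$ is the factorization $w = q_1 \cdots q_{z'}$ into non-empty phrases such that, for every $i$, the string $q_i$ without its last letter is the longest prefix of $q_i \cdots q_{z'}$ that occurs as a suffix of $q_1\cdots q_j$ for some $0 \le j < i$; as an exception, the last phrase $q_{z'}$ may itself be a suffix of $q_1 \cdots q_j$ for some $j < z'$. Every string has exactly one such factorization; let $z_{\mathrm{End}}(w)$ be its number of phrases. Let $S_k$ be the $k$-th period-doubling sequence: $S_0 = a$ and $S_k = \varphi(S_{k-1})$ for $k \ge 1$, where $\varphi$ is the morphism with $\varphi(a)=ab$, $\varphi(b)=aa$. Let $\mathcal{K}$ be the set of integers $k \ge 5$ such that the LZ-End phrase of $S_k$ with index $z_{\mathrm{End}}(S_{k-1})$ equals the last LZ-End phrase of $S_{k-1}$, and let $k^*_m$ be the $m$-th smallest element of $\mathcal{K}$ ($m \ge 1$). Theorem. There is a function $f$ from the non-negative integers to the integers such that $z_{\mathrm{End}}(S_k) = 2k - f(k)$ for all $k \ge 0$ and $f(k) = O(\log^* k)$ as $k \to \infty$, where $\log^* k$ is the least number of times the binary logarithm must be applied to $k$ to reach a value at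 most $1$. More precisely, for all $k \ge 5$ and $m \ge 1$, if $k^*_m - 1 \le k \le k^*_{m+1} - 2$, then $f(k) = m+1$. Moreover, all $k^*_m$ exist, $k^*_1 = 5$, and $k^*_m = k^*_{m-1} + \frac{3}{16}\cdot 2^{k^*_{m-1}}$ for $m \ge 2$. -/

import Mathlib

open Asymptotics Filter

/-- `OccursAtPhraseEnd P x`: the string `x` is a suffix of `p₁ ⋯ pⱼ` for some `j ≤ |P|`, where
`P = [p₁, …, p_r]` is a list of phrases (`j = 0` gives the empty string). -/
def OccursAtPhraseEnd {α : Type*} (P : List (List α)) (x : List α) : Prop :=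
  ∃ j, j ≤ P.length ∧ x <:+ (P.take j).flatten

/-- `IsLZEndPhrase P q R`: after the phrases `P`, when the string `q ++ R` remains to be factorized,
`q` is a correct next phrase. Either `q` without its last letter is the longest prefix of
`q ++ R` that occurs as a suffix of `p₁ ⋯ pⱼ` for some `j`, or `q` is the whole remaining
string (so it is the last phrase) and occurs itself as such a suffix. -/
def IsLZEndPhrase {α : Type*} (P : List (List α)) (q R : List α) : Prop :=
  q ≠ [] ∧
    ((OccursAtPhraseEnd P q.dropLast ∧
        ∀ x, x <+: q ++ R → OccursAtPhraseEnd P x → x.length ≤ q.dropLast.length) ∨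
      (R = [] ∧ OccursAtPhraseEnd P q))

/-- `q` is an LZ-End factorization of the string `w`. -/
def IsLZEndFactorization {α : Type*} (w : List α) (q : List (List α)) : Prop :=
  q.flatten = w ∧
    ∀ (i : ℕ) (hi : i < q.length), IsLZEndPhrase (q.take i) q[i] (q.drop (i + 1)).flatten

theorem OccursAtPhraseEnd.nil {α : Type*} (P : List (List α)) : OccursAtPhraseEnd P [] :=
  ⟨0, Nat.zero_le _, List.nil_suffix⟩

theorem IsLZEndPhrase.exists_of_ne_nil {α : Type*} (P : List (List α)) (w : List α) (hw : w ≠ []) :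
    ∃ q R, q ++ R = w ∧ IsLZEndPhrase P q R := by
  classical
  by_cases h : OccursAtPhraseEnd P w
  · exact ⟨w, [], by simp, hw, Or.inr ⟨rfl, h⟩⟩
  · have hex : ∃ l, l ≤ w.length ∧ OccursAtPhraseEnd P (w.take l) :=
      ⟨0, Nat.zero_le _, by simpa using OccursAtPhraseEnd.nil P⟩
    obtain ⟨l, ⟨hl, hocc⟩, hmax⟩ : ∃ l, (l ≤ w.length ∧ OccursAtPhraseEnd P (w.take l)) ∧
        ∀ l', l' ≤ w.length → OccursAtPhraseEnd P (w.take l') → l' ≤ l := by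
      refine ⟨Nat.findGreatest (fun l => OccursAtPhraseEnd P (w.take l)) w.length,
        ⟨Nat.findGreatest_le _, ?_⟩, fun l' h1 h2 => Nat.le_findGreatest h1 h2⟩
      exact Nat.findGreatest_spec (P := fun l => OccursAtPhraseEnd P (w.take l))
        (Nat.zero_le _) (by simpa using OccursAtPhraseEnd.nil P)
    have hlt : l < w.length := by
      rcases Nat.lt_or_ge l w.length with h1 | h1
      · exact h1
      · rw [List.take_of_length_le h1] at hocc
        exact absurd hocc h
    have hdl : (w.take (l + 1)).dropLast = w.take l := by
      rw [List.dropLast_eq_take, List.take_take, List.length_take]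
      congr 1
      omega
    refine ⟨w.take (l + 1), w.drop (l + 1), List.take_append_drop _ _, ?_, Or.inl ⟨?_, ?_⟩⟩
    · intro h0
      have := congrArg List.length h0
      simp at this
      exact hw this
    · rw [hdl]; exact hocc
    · intro x hx hxo
      rw [List.take_append_drop] at hx
      rw [hdl, List.length_take, Nat.min_eq_left hl]
      refine hmax _ hx.length_le ?_
      rwa [← List.prefix_iff_eq_take.mp hx]

theorem IsLZEndPhrase.unique {α : Type*} {P : List (List α)} {q R q' R' : List α}
    (h : IsLZEndPhrase P q R) (h' : IsLZEndPhrase P q' R') (he : q ++ R = q' ++ R') : q = q' := by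
  have key : q.length = q'.length := by
    have p1 : 0 < q.length := List.length_pos_of_ne_nil h.1
    have p2 : 0 < q'.length := List.length_pos_of_ne_nil h'.1
    have hl := congrArg List.length he
    simp only [List.length_append] at hl
    rcases h.2 with ⟨ho, hm⟩ | ⟨hR, ho⟩ <;> rcases h'.2 with ⟨ho', hm'⟩ | ⟨hR', ho'⟩
    · have a1 := hm _ (he ▸ (List.dropLast_prefix q').trans (List.prefix_append _ _)) ho'
      have a2 := hm' _ (he ▸ (List.dropLast_prefix q).trans (List.prefix_append _ _)) ho
      simp only [List.length_dropLast] at a1 a2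
      omega
    · have a1 := hm _ (he ▸ List.prefix_append _ _) ho'
      subst hR'
      simp only [List.length_dropLast, List.length_nil] at a1 hl
      omega
    · have a1 := hm' _ (he ▸ List.prefix_append _ _) ho
      subst hR
      simp only [List.length_dropLast, List.length_nil] at a1 hl
      omega
    · subst hR hR'
      simpa using hl
  exact (List.append_inj he key).1

theorem existsUnique_lzEnd_aux {α : Type*} (n : ℕ) : ∀ (P : List (List α)) (w : List α),
    w.length ≤ n → ∃! q : List (List α), q.flatten = w ∧
      ∀ (i : ℕ) (hi : i < q.length),
        IsLZEndPhrase (P ++ q.take i) q[i] (q.drop (i + 1)).flatten := by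
  have hnil : ∀ (P : List (List α)), ∃! q : List (List α), q.flatten = [] ∧
      ∀ (i : ℕ) (hi : i < q.length),
        IsLZEndPhrase (P ++ q.take i) q[i] (q.drop (i + 1)).flatten := by
    intro P
    refine ⟨[], ⟨rfl, fun i hi => absurd hi (by simp)⟩, ?_⟩
    rintro (_ | ⟨q, qs⟩) ⟨hf, hq⟩
    · rfl
    · have := (hq 0 (by simp)).1
      simp at hf this
      exact absurd hf.1 this
  induction n with
  | zero =>
    intro P w hw
    obtain rfl : w = [] := List.length_eq_zero_iff.mp (by omega)
    exact hnil P
  | succ n ih =>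
    intro P w hw
    by_cases hw0 : w = []
    · subst hw0; exact hnil P
    obtain ⟨q, R, rfl, hq⟩ := IsLZEndPhrase.exists_of_ne_nil P w hw0
    have hpos : 0 < q.length := List.length_pos_of_ne_nil hq.1
    obtain ⟨qs, ⟨hf, hqs⟩, huniq⟩ := ih (P ++ [q]) R (by
      rw [List.length_append] at hw; omega)
    refine ⟨q :: qs, ⟨by simp [hf], ?_⟩, ?_⟩
    · rintro (_ | i) hi
      · simpa [hf] using hq
      · simpa using hqs i (by simpa using hi)
    · rintro (_ | ⟨q', qs'⟩) ⟨hf', hq'⟩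
      · exact absurd hf'.symm hw0
      · have h0 := hq' 0 (by simp)
        simp only [List.take_zero, List.append_nil, List.getElem_cons_zero, Nat.zero_add,
          List.drop_succ_cons, List.drop_zero] at h0
        rw [List.flatten_cons] at hf'
        obtain rfl : q' = q := h0.unique hq hf'
        have hR : qs'.flatten = R := List.append_cancel_left hf'
        rw [huniq qs' ⟨hR, fun i hi => ?_⟩]
        have h2 := hq' (i + 1) (Nat.succ_lt_succ hi)
        rw [List.getElem_cons_succ] at h2
        simpa using h2

/-- Every string has exactly one LZ-End factorization. -/
theorem existsUnique_isLZEndFactorization {α : Type*} (w : List α) :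
    ∃! q, IsLZEndFactorization w q := by
  simpa [IsLZEndFactorization] using existsUnique_lzEnd_aux w.length [] w le_rfl

/-- The LZ-End factorization of `w`, as the list of its phrases. -/
noncomputable def lzEnd {α : Type*} (w : List α) : List (List α) :=
  (existsUnique_isLZEndFactorization w).choose

theorem lzEnd_spec {α : Type*} (w : List α) : IsLZEndFactorization w (lzEnd w) :=
  (existsUnique_isLZEndFactorization w).choose_spec.1

theorem lzEnd_eq {α : Type*} {w : List α} {q : List (List α)} (h : IsLZEndFactorization w q) :
    lzEnd w = q :=
  (existsUnique_isLZEndFactorization w).unique (lzEnd_spec w) h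

/-- The number of phrases of the LZ-End factorization of `w`. -/
noncomputable def lzEndCount {α : Type*} (w : List α) : ℕ := (lzEnd w).length

/-- The binary alphabet `{a, b}`. -/
inductive Letter where
  | a : Letter
  | b : Letter
  deriving DecidableEq

/-- The images of the letters under the period-doubling morphism: `a ↦ ab`, `b ↦ aa`. -/
def pdMorphism : Letter → List Letter
  | Letter.a => [Letter.a, Letter.b]
  | Letter.b => [Letter.a, Letter.a]

/-- The `k`-th period-doubling sequence. -/
def periodDoubling : ℕ → List Letter
  | 0 => [Letter.a]
  | k + 1 => (periodDoubling k).flatMap pdMorphism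

/-- The integers `k ≥ 5` such that, with `z` the number of LZ-End phrases of `S_{k-1}`, the `z`-th
LZ-End phrase of `S_k` exists and equals the last LZ-End phrase of `S_{k-1}`. -/
def lastPhraseKept (k : ℕ) : Prop :=
  5 ≤ k ∧ (lzEnd (periodDoubling k))[lzEndCount (periodDoubling (k - 1)) - 1]? =
    (lzEnd (periodDoubling (k - 1))).getLast?

/-- For `m ≥ 1`, the `m`-th smallest integer `k` satisfying `lastPhraseKept k`. -/
noncomputable def kStar (m : ℕ) : ℕ := Nat.nth lastPhraseKept (m - 1)

theorem exists_iterate_logb_le_one (x : ℝ) : ∃ n : ℕ, (Real.logb 2)^[n] x ≤ 1 := by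
  have key : ∀ (N : ℕ) (x : ℝ), x ≤ N + 1 → ∃ n : ℕ, (Real.logb 2)^[n] x ≤ 1 := by
    intro N
    induction N with
    | zero => intro x hx; exact ⟨0, by simpa using hx⟩
    | succ N ih =>
      intro x hx
      rcases le_or_gt x 2 with h2 | h2
      · rcases le_or_gt x 1 with h1 | h1
        · exact ⟨0, by simpa using h1⟩
        · refine ⟨1, ?_⟩
          simp only [Function.iterate_one]
          rw [Real.logb_le_iff_le_rpow (by norm_num) (by linarith)]
          simpa using h2
      · have hlog : Real.logb 2 x ≤ x - 1 := by
          rw [Real.logb_le_iff_le_rpow (by norm_num) (by linarith)]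
          have := one_add_mul_self_le_rpow_one_add (s := 1) (by norm_num) (p := x - 1)
            (by linarith)
          norm_num at this
          exact this
        obtain ⟨n, hn⟩ := ih (Real.logb 2 x) (by push_cast at hx; linarith)
        exact ⟨n + 1, by simpa using hn⟩
  obtain ⟨N, hN⟩ := exists_nat_ge x
  exact key N x (by linarith)

open Classical in
/-- The iterated logarithm `log* x`: the least number of times that the binary logarithm has to be
applied to `x` to reach a value at most `1`. -/
noncomputable def logStar (x : ℝ) : ℕ := Nat.find (exists_iterate_logb_le_one x)

/-!
The letter `j` of the infinite period-doubling word is determined by the parity of the 2-adic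
valuation of `j`. So a shift by a multiple of `2 ^ d` changes no letter at a position that `2 ^ d`
does not divide, while any `3 * 2 ^ d` consecutive letters determine their position modulo
`2 ^ (d + 1)`. These two facts evaluate the greedy matches: the phrases come in cycles. A cycle
starts where a phrase ends exactly with some `periodDoubling (e + 3)`; the next phrase has
`5 * 2 ^ e + 1` letters, and then phrases of lengths `4 * 2 ^ n + 1` and `12 * 2 ^ n` alternate for
`n = e, e + 1, …`. Such a pair of phrases leads from `r` letters before position `16 * 2 ^ n` to
`r - 1` letters before `32 * 2 ^ n`. When the gap closes, the next cycle starts, with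
`e + 3 * 2 ^ e` in place of `e`. While the gap is open, its `r` letters form one more phrase of
`periodDoubling (n + 4)`, which is saved when it closes: the number of phrases grows by two from
each `periodDoubling k` to the next, except for this loss of one phrase per cycle.
-/

section Factorization

variable {α : Type*} {P : List (List α)} {q x R : List α}

theorem occursAtPhraseEnd_concat :
    OccursAtPhraseEnd (P ++ [q]) x ↔ OccursAtPhraseEnd P x ∨ x <:+ P.flatten ++ q := by
  constructor
  · rintro ⟨j, -, hx⟩
    rcases Nat.lt_or_ge P.length j with hjP | hjP
    · rw [List.take_of_length_le (by simpa using hjP)] at hx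
      exact .inr (by simpa using hx)
    · exact .inl ⟨j, hjP, by rwa [List.take_append_of_le_length hjP] at hx⟩
  · rintro (⟨j, hj, hx⟩ | hx)
    · exact ⟨j, by grind, by rwa [List.take_append_of_le_length hj]⟩
    · exact ⟨(P ++ [q]).length, le_rfl, by rwa [List.take_length, List.flatten_concat]⟩

theorem IsLZEndPhrase.of_occursAtPhraseEnd_dropLast (hq : q ≠ [])
    (h : OccursAtPhraseEnd P q.dropLast) : IsLZEndPhrase P q [] := by
  refine ⟨hq, or_iff_not_imp_right.2 fun hnot => ⟨h, fun x hx hocc => ?_⟩⟩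
  rw [List.append_nil] at hx
  have hlt : x.length < q.length :=
    hx.length_le.lt_of_ne fun hlen => hnot ⟨rfl, hx.eq_of_length hlen ▸ hocc⟩
  grind

/-- The phrases `P` are the first LZ-End phrases of `P.flatten ++ R`. -/
def IsLZEndPrefix (P : List (List α)) (R : List α) : Prop :=
  ∀ (i : ℕ) (hi : i < P.length), IsLZEndPhrase (P.take i) P[i] ((P.drop (i + 1)).flatten ++ R)

theorem isLZEndPrefix_nil (R : List α) : IsLZEndPrefix [] R :=
  fun _ hi => absurd hi (Nat.not_lt_zero _)

theorem IsLZEndPrefix.concat (h : IsLZEndPrefix P (q ++ R)) (hq : IsLZEndPhrase P q R) :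
    IsLZEndPrefix (P ++ [q]) R := by
  intro i hi
  rcases Nat.lt_succ_iff_lt_or_eq.1 (by simpa using hi) with hiP | rfl
  · have := h i hiP
    rw [List.take_append_of_le_length hiP.le, List.getElem_append_left hiP,
      List.drop_append_of_le_length hiP]
    simpa using this
  · simpa using hq

theorem IsLZEndPrefix.lzEnd_flatten (h : IsLZEndPrefix P []) : lzEnd P.flatten = P :=
  lzEnd_eq ⟨rfl, fun i hi => by simpa using h i hi⟩

end Factorization

section Factor

variable {α : Type*} (u : ℕ → α)

/-- The factor `u_{y+1} ⋯ u_{y+l}` of the infinite word `u = u₁u₂⋯`: the `l` letters that follow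
position `y`. Letters are numbered from `1`, so `u 0` is never read. -/
def factor (y l : ℕ) : List α := (List.range' (y + 1) l).map u

@[simp] theorem length_factor (y l : ℕ) : (factor u y l).length = l := by simp [factor]

theorem factor_append (y l m : ℕ) : factor u y l ++ factor u (y + l) m = factor u y (l + m) := by
  rw [factor, factor, factor, ← List.range'_append_1, List.map_append, add_right_comm]

theorem dropLast_factor (y l : ℕ) : (factor u y (l + 1)).dropLast = factor u y l := by
  rw [← factor_append]
  exact List.dropLast_concat

variable {u} {x y l l' p : ℕ} {E : List ℕ}

theorem factor_ne_nil (hl : 0 < l) : factor u y l ≠ [] :=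
  List.ne_nil_of_length_pos (by rwa [length_factor])

theorem factor_eq_factor_iff :
    factor u x l = factor u y l ↔ ∀ s, 1 ≤ s → s ≤ l → u (x + s) = u (y + s) := by
  constructor
  · intro h s hs hsl
    have := congrArg (·[s - 1]?) h
    grind [factor]
  · intro h
    refine List.ext_getElem (by simp) fun s hs _ => ?_
    have := h (s + 1)
    grind [factor]

theorem factor_eq_factor_of_le (hl : l' ≤ l) (h : factor u x l = factor u y l) :
    factor u x l' = factor u y l' :=
  factor_eq_factor_iff.2 fun s hs hsl => factor_eq_factor_iff.1 h s hs (hsl.trans hl)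

theorem eq_factor_length_of_prefix {v : List α} (h : v <+: factor u y l) :
    v = factor u y v.length := by
  obtain ⟨m, rfl⟩ := Nat.exists_eq_add_of_le (by simpa using h.length_le)
  rw [← factor_append] at h
  exact (List.prefix_of_prefix_length_le h (List.prefix_append _ _) (by simp)).eq_of_length
    (by simp)

theorem factor_suffix_factor_zero_iff :
    factor u y l <:+ factor u 0 p ↔ ∃ x, x + l = p ∧ factor u x l = factor u y l := by
  constructor
  · intro h
    obtain ⟨x, rfl⟩ := Nat.exists_eq_add_of_le' (by simpa using h.length_le)
    rw [← factor_append, zero_add] at h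
    exact ⟨x, rfl, ((List.suffix_of_suffix_length_le h (List.suffix_append _ _)
      (by simp)).eq_of_length (by simp)).symm⟩
  · rintro ⟨x, rfl, h⟩
    rw [← factor_append, zero_add, h]
    exact List.suffix_append _ _

variable (u) in
/-- The lengths `l` for which the `l` letters of `u` after position `y` also occur ending at one of
the positions in `E`. -/
def matchLengths (E : List ℕ) (y : ℕ) : Set ℕ :=
  {l | ∃ p ∈ E, factor u y l <:+ factor u 0 p}

theorem mem_matchLengths_iff :
    l ∈ matchLengths u E y ↔ ∃ x, x + l ∈ E ∧ factor u x l = factor u y l := by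
  simp only [matchLengths, Set.mem_ofPred_eq, factor_suffix_factor_zero_iff]
  grind

theorem mem_matchLengths_cons :
    l ∈ matchLengths u (p :: E) y ↔ factor u y l <:+ factor u 0 p ∨ l ∈ matchLengths u E y := by
  simp [matchLengths]

theorem isGreatest_matchLengths_iff : IsGreatest (matchLengths u E y) l ↔
    (∃ p ∈ E, factor u y l <:+ factor u 0 p) ∧
      ∀ p ∈ E, ∀ l' ≤ p, factor u y l' <:+ factor u 0 p → l' ≤ l := by
  refine and_congr_right fun _ => ⟨fun h p hp l' _ hl' => h ⟨p, hp, hl'⟩, ?_⟩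
  rintro h l' ⟨p, hp, hl'⟩
  exact h p hp l' (by simpa using hl'.length_le) hl'

end Factor

section Chain

variable {α : Type*} {u : ℕ → α} {y r : ℕ} {L : List ℕ}

/-- `LZEndChain u y L`: the position `y` is a phrase boundary of the greedy LZ-End parsing of the
infinite word `u`, and `L` lists the earlier boundaries, the latest first and `0` last. -/
inductive LZEndChain (u : ℕ → α) : ℕ → List ℕ → Prop
  | zero : LZEndChain u 0 []
  | step {y l : ℕ} {L : List ℕ} (h : LZEndChain u y L)
      (hl : IsGreatest (matchLengths u (y :: L) y) l) : LZEndChain u (y + l + 1) (y :: L)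

/-- The phrases of `u` up to the boundary `z`, where `L` lists the earlier boundaries as in
`LZEndChain`. -/
def phrases (u : ℕ → α) : ℕ → List ℕ → List (List α)
  | _, [] => []
  | z, y :: L => phrases u y L ++ [factor u y (z - y)]

@[simp] theorem length_phrases (u : ℕ → α) (y : ℕ) (L : List ℕ) :
    (phrases u y L).length = L.length := by
  induction L generalizing y with
  | nil => rfl
  | cons x L ih => simp [phrases, ih]

theorem phrases_add_succ (u : ℕ → α) (y l : ℕ) (L : List ℕ) :
    phrases u (y + l + 1) (y :: L) = phrases u y L ++ [factor u y (l + 1)] := by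
  rw [phrases, add_assoc, Nat.add_sub_cancel_left]

namespace LZEndChain

theorem flatten_phrases (h : LZEndChain u y L) : (phrases u y L).flatten = factor u 0 y := by
  induction h with
  | zero => rfl
  | @step y l L _ _ ih =>
    rw [phrases_add_succ, List.flatten_concat, ih, add_assoc, ← factor_append u 0 y, zero_add]

theorem occursAtPhraseEnd_phrases_iff (h : LZEndChain u y L) {x l : ℕ} :
    OccursAtPhraseEnd (phrases u y L) (factor u x l) ↔ l ∈ matchLengths u (y :: L) x := by
  induction h with
  | zero => simp [phrases, OccursAtPhraseEnd, matchLengths, factor]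
  | @step y k L h _ ih =>
    rw [phrases_add_succ, occursAtPhraseEnd_concat, ih, h.flatten_phrases,
      mem_matchLengths_cons (E := y :: L), or_comm, add_assoc, ← factor_append u 0 y, zero_add]

theorem isLZEndPrefix_phrases (h : LZEndChain u y L) (m : ℕ) :
    IsLZEndPrefix (phrases u y L) (factor u y m) := by
  induction h generalizing m with
  | zero => exact isLZEndPrefix_nil _
  | @step y l L h hl ih =>
    have hsplit : factor u y (l + 1) ++ factor u (y + l + 1) m = factor u y (l + 1 + m) :=
      factor_append u y (l + 1) m
    rw [phrases_add_succ]
    refine IsLZEndPrefix.concat (hsplit ▸ ih _) ⟨factor_ne_nil l.succ_pos, .inl ⟨?_, ?_⟩⟩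
    · rw [dropLast_factor, h.occursAtPhraseEnd_phrases_iff]
      exact hl.1
    · intro v hv hocc
      rw [hsplit] at hv
      rw [eq_factor_length_of_prefix hv, h.occursAtPhraseEnd_phrases_iff] at hocc
      simpa using hl.2 hocc

theorem lzEnd_factor (h : LZEndChain u y L) : lzEnd (factor u 0 y) = phrases u y L := by
  rw [← h.flatten_phrases]
  exact (h.isLZEndPrefix_phrases 0).lzEnd_flatten

theorem lzEnd_factor_add_succ (h : LZEndChain u y L) (hr : r ∈ matchLengths u (y :: L) y) :
    lzEnd (factor u 0 (y + (r + 1))) = phrases u y L ++ [factor u y (r + 1)] := by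
  have hlast : IsLZEndPhrase (phrases u y L) (factor u y (r + 1)) [] := by
    refine .of_occursAtPhraseEnd_dropLast (factor_ne_nil r.succ_pos) ?_
    rwa [dropLast_factor, h.occursAtPhraseEnd_phrases_iff]
  have hprefix : IsLZEndPrefix (phrases u y L) (factor u y (r + 1) ++ []) := by
    rw [List.append_nil]
    exact h.isLZEndPrefix_phrases (r + 1)
  rw [← (hprefix.concat hlast).lzEnd_flatten, List.flatten_concat, h.flatten_phrases,
    ← factor_append u 0 y, zero_add]

end LZEndChain

end Chain

section PeriodDoubling

/-- The `j`-th letter, `j ≥ 1`, of the infinite period-doubling word, the common extension of all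
`periodDoubling k`. -/
def pdLetter (j : ℕ) : Letter := if Even (padicValNat 2 j) then .a else .b

theorem pdLetter_eq_pdLetter_iff {i j : ℕ} :
    pdLetter i = pdLetter j ↔ (Even (padicValNat 2 i) ↔ Even (padicValNat 2 j)) := by
  grind [pdLetter]

theorem pdLetter_of_odd {j : ℕ} (hj : Odd j) : pdLetter j = .a := by
  rw [pdLetter, padicValNat.eq_zero_of_not_dvd hj.not_two_dvd_nat, if_pos Even.zero]

theorem pdLetter_two_mul_eq_a_iff {j : ℕ} (hj : j ≠ 0) :
    pdLetter (2 * j) = .a ↔ pdLetter j = .b := by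
  have hval := padicValNat_base_pow_mul one_lt_two hj 1
  grind [pdLetter]

theorem pdLetter_two_pow_mul_eq_iff (d : ℕ) {i j : ℕ} (hi : i ≠ 0) (hj : j ≠ 0) :
    pdLetter (2 ^ d * i) = pdLetter (2 ^ d * j) ↔ pdLetter i = pdLetter j := by
  rw [pdLetter_eq_pdLetter_iff, pdLetter_eq_pdLetter_iff, padicValNat_base_pow_mul one_lt_two hi,
    padicValNat_base_pow_mul one_lt_two hj, Nat.even_add, Nat.even_add]
  tauto

theorem pdLetter_add_two_pow_mul {d i : ℕ} (hi : ¬2 ^ d ∣ i) (o : ℕ) :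
    pdLetter (i + 2 ^ d * o) = pdLetter i := by
  have hi0 : i ≠ 0 := by rintro rfl; exact hi (dvd_zero _)
  obtain ⟨v, m, hm, rfl⟩ := Nat.exists_eq_two_pow_mul_odd hi0
  obtain ⟨c, rfl⟩ : ∃ c, d = v + (c + 1) := by
    have hvd : v < d := not_le.1 fun hdv => hi ((pow_dvd_pow 2 hdv).mul_right m)
    exact ⟨d - v - 1, by omega⟩
  have hodd : Odd (m + 2 ^ (c + 1) * o) :=
    hm.add_even ((even_two.pow_of_ne_zero c.succ_ne_zero).mul_right o)
  rw [pow_add, mul_assoc, ← mul_add, pdLetter_two_pow_mul_eq_iff v hodd.pos.ne' hm.pos.ne',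
    pdLetter_of_odd hodd, pdLetter_of_odd hm]

theorem pdMorphism_pdLetter {j : ℕ} (hj : j ≠ 0) :
    pdMorphism (pdLetter j) = [pdLetter (2 * j - 1), pdLetter (2 * j)] := by
  have hodd : pdLetter (2 * j - 1) = .a := pdLetter_of_odd (by grind)
  have heven := pdLetter_two_mul_eq_a_iff hj
  rw [hodd]
  cases h : pdLetter j <;> cases h' : pdLetter (2 * j) <;> simp_all [pdMorphism]

theorem flatMap_pdMorphism_factor (m : ℕ) :
    (factor pdLetter 0 m).flatMap pdMorphism = factor pdLetter 0 (2 * m) := by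
  induction m with
  | zero => rfl
  | succ m ih =>
    have hlast : (factor pdLetter m 1).flatMap pdMorphism = factor pdLetter (2 * m) 2 := by
      simp [factor, pdMorphism_pdLetter, List.range'_succ, mul_add]
    rw [← factor_append, List.flatMap_append, ih, zero_add, hlast, mul_add, ← factor_append,
      zero_add]

theorem periodDoubling_eq_factor (k : ℕ) : periodDoubling k = factor pdLetter 0 (2 ^ k) := by
  induction k with
  | zero => decide +kernel
  | succ k ih => rw [periodDoubling, ih, flatMap_pdMorphism_factor, pow_succ']

end PeriodDoubling

section Recurrence

variable {d e i j l s x y : ℕ}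

theorem factor_pdLetter_add_two_pow_mul (o : ℕ)
    (h : ∀ s, 1 ≤ s → s ≤ l → ¬2 ^ d ∣ x + s) :
    factor pdLetter (x + 2 ^ d * o) l = factor pdLetter x l := by
  refine factor_eq_factor_iff.2 fun s hs hsl => ?_
  rw [add_right_comm, pdLetter_add_two_pow_mul (h s hs hsl)]

theorem pdLetter_eq_of_factor_eq (h : factor pdLetter x l = factor pdLetter y l) (hs : 1 ≤ s)
    (hsl : s ≤ l) (hx : x + s = 2 ^ e * i) (hy : y + s = 2 ^ e * j) :
    pdLetter i = pdLetter j := by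
  have hi : i ≠ 0 := by rintro rfl; omega
  have hj : j ≠ 0 := by rintro rfl; omega
  rw [← pdLetter_two_pow_mul_eq_iff e hi hj, ← hx, ← hy]
  exact factor_eq_factor_iff.1 h s hs hsl

theorem factor_pdLetter_three_ne (hx : Even x) (hy : Odd y) :
    factor pdLetter x 3 ≠ factor pdLetter y 3 := by
  intro h
  -- One of `y + 1`, `y + 3` is twice an odd number, hence carries the letter `b`.
  obtain ⟨s, hs, hs3, hsodd, j, hj, hjodd⟩ :
      ∃ s, 1 ≤ s ∧ s ≤ 3 ∧ Odd s ∧ ∃ j, y + s = 2 * j ∧ Odd j := by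
    obtain ⟨m, rfl⟩ := hy
    obtain hm | hm := m.even_or_odd
    · exact ⟨1, le_rfl, by decide, by decide, m + 1, by ring, hm.add_one⟩
    · exact ⟨3, by decide, le_rfl, by decide, m + 2, by ring, hm.add_even even_two⟩
  have hxs : pdLetter (2 * j) = .a := by
    rw [← hj, ← factor_eq_factor_iff.1 h s hs hs3, pdLetter_of_odd (hx.add_odd hsodd)]
  rw [pdLetter_two_mul_eq_a_iff hjodd.pos.ne', pdLetter_of_odd hjodd] at hxs
  cases hxs

theorem modEq_two_of_factor_pdLetter_eq (h : factor pdLetter x 3 = factor pdLetter y 3) :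
    x ≡ y [MOD 2] := by
  rcases x.even_or_odd with hx | hx <;> rcases y.even_or_odd with hy | hy
  · grind [Nat.ModEq]
  · exact absurd h (factor_pdLetter_three_ne hx hy)
  · exact absurd h.symm (factor_pdLetter_three_ne hy hx)
  · grind [Nat.ModEq]

theorem factor_pdLetter_half {c : ℕ} (hc : c ≤ 1)
    (h : factor pdLetter (2 * x + c) (2 * l) = factor pdLetter (2 * y + c) (2 * l)) :
    factor pdLetter x l = factor pdLetter y l := by
  refine factor_eq_factor_iff.2 fun s hs hsl => ?_
  exact pdLetter_eq_of_factor_eq (e := 1) h (s := 2 * s - c) (by omega) (by omega) (by omega)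
    (by omega)

theorem modEq_two_pow_of_factor_pdLetter_eq
    (h : factor pdLetter x (3 * 2 ^ d) = factor pdLetter y (3 * 2 ^ d)) :
    x ≡ y [MOD 2 ^ (d + 1)] := by
  induction d generalizing x y with
  | zero => exact modEq_two_of_factor_pdLetter_eq h
  | succ d ih =>
    have hpos : 0 < 2 ^ d := by positivity
    rw [pow_succ', mul_left_comm] at h
    have hparity : x % 2 = y % 2 :=
      modEq_two_of_factor_pdLetter_eq (factor_eq_factor_of_le (by omega) h)
    rw [← Nat.div_add_mod x 2, ← Nat.div_add_mod y 2, hparity] at h ⊢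
    have hhalf := ih (factor_pdLetter_half (by omega) h)
    rw [pow_succ' 2 (d + 1)]
    exact (hhalf.mul_left' 2).add_right _

theorem two_pow_dvd_add_iff_of_factor_pdLetter_eq (hl : 3 * 2 ^ d ≤ l)
    (h : factor pdLetter x l = factor pdLetter y l) (r : ℕ) :
    2 ^ (d + 1) ∣ x + r ↔ 2 ^ (d + 1) ∣ y + r :=
  ((modEq_two_pow_of_factor_pdLetter_eq (factor_eq_factor_of_le hl h)).add_right r).dvd_iff dvd_rfl

end Recurrence

section PhraseLengths

variable {e r y : ℕ} {E : List ℕ}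

theorem isGreatest_matchLengths_five_mul (h5 : 5 * 2 ^ e ∈ E)
    (hE : ∀ p ∈ E, p = 8 * 2 ^ e ∨ p ≤ 5 * 2 ^ e) :
    IsGreatest (matchLengths pdLetter E (8 * 2 ^ e)) (5 * 2 ^ e) := by
  have hpos : 0 < 2 ^ e := by positivity
  have hpow3 : 2 ^ (e + 3) = 8 * 2 ^ e := by ring
  constructor
  · have hperiod := factor_pdLetter_add_two_pow_mul (d := e + 3) (x := 0) (l := 5 * 2 ^ e) 1
      fun s hs hsl => Nat.not_dvd_of_pos_of_lt (by omega) (by omega)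
    rw [zero_add, mul_one, hpow3] at hperiod
    exact mem_matchLengths_iff.2 ⟨0, by rwa [zero_add], hperiod.symm⟩
  · intro l hl
    obtain ⟨x, hxE, h⟩ := mem_matchLengths_iff.1 hl
    by_contra! hlong
    have hsource : x + l = 8 * 2 ^ e := (hE _ hxE).resolve_right (by omega)
    obtain ⟨c, hc⟩ : 2 ^ (e + 1) ∣ x + 0 :=
      (two_pow_dvd_add_iff_of_factor_pdLetter_eq (by omega) h 0).2 ⟨4, by omega⟩
    have hc2 : c < 2 := Nat.lt_of_mul_lt_mul_left (a := 2 ^ (e + 1)) (by omega)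
    interval_cases c
    · exact absurd (pdLetter_eq_of_factor_eq (s := 8 * 2 ^ e) (e := e) (i := 8) (j := 16) h
        (by omega) (by omega) (by omega) (by omega)) (by decide +kernel)
    · exact absurd (pdLetter_eq_of_factor_eq (s := 2 * 2 ^ e) (e := e) (i := 4) (j := 10) h
        (by omega) (by omega) (by omega) (by omega)) (by decide +kernel)

theorem factor_pdLetter_add_four_mul {x : ℕ} (hx : x + r = 12 * 2 ^ e) (hr : 1 ≤ r)
    (hr' : r < 3 * 2 ^ e) :
    factor pdLetter (x + 4 * 2 ^ e) (4 * 2 ^ e) = factor pdLetter x (4 * 2 ^ e) := by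
  have hpow2 : 2 ^ (e + 2) = 4 * 2 ^ e := by ring
  refine factor_eq_factor_iff.2 fun s hs hsl => ?_
  rw [add_right_comm]
  rcases eq_or_ne s r with rfl | hsr
  · rw [hx, ← add_mul, mul_comm, mul_comm 12, pdLetter_two_pow_mul_eq_iff e (by omega) (by omega)]
    decide +kernel
  · have hndvd : ¬2 ^ (e + 2) ∣ x + s := by
      rcases hsr.lt_or_gt with hlt | hgt
      · exact Nat.not_dvd_of_lt_of_lt_mul_succ (k := 2) (by omega) (by omega)
      · exact Nat.not_dvd_of_lt_of_lt_mul_succ (k := 3) (by omega) (by omega)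
    rw [← hpow2, ← mul_one (2 ^ (e + 2)), pdLetter_add_two_pow_mul hndvd]

theorem isGreatest_matchLengths_four_mul (hy : y + r = 16 * 2 ^ e) (hr : 1 ≤ r)
    (hr' : r < 3 * 2 ^ e) (hyE : y ∈ E) (hle : ∀ p ∈ E, p ≤ y)
    (hgap : ∀ p ∈ E, p + r ≤ 8 * 2 ^ e ∨ 8 * 2 ^ e ≤ p) :
    IsGreatest (matchLengths pdLetter E y) (4 * 2 ^ e) := by
  constructor
  · obtain ⟨x, rfl⟩ : ∃ x, y = x + 4 * 2 ^ e := ⟨y - 4 * 2 ^ e, by omega⟩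
    exact mem_matchLengths_iff.2 ⟨x, hyE, (factor_pdLetter_add_four_mul (by omega) hr hr').symm⟩
  · intro l hl
    obtain ⟨x, hxE, h⟩ := mem_matchLengths_iff.1 hl
    by_contra! hlong
    have hxy := hle _ hxE
    have hxgap := hgap _ hxE
    obtain ⟨c, hc⟩ : 2 ^ (e + 1) ∣ x + r :=
      (two_pow_dvd_add_iff_of_factor_pdLetter_eq (by omega) h r).2 ⟨8, by omega⟩
    have hc6 : c < 6 := Nat.lt_of_mul_lt_mul_left (a := 2 ^ (e + 1)) (by omega)
    have hc0 : c ≠ 0 := by rintro rfl; omega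
    -- Comparing the letters `r` places on excludes every alignment but `x + r = 4 * 2 ^ e`.
    have hletter : pdLetter c = pdLetter 8 :=
      pdLetter_eq_of_factor_eq h hr (by omega) hc (by omega)
    obtain rfl : c = 2 :=
      (by decide +kernel : ∀ c < 6, c ≠ 0 → pdLetter c = pdLetter 8 → c = 2) c hc6 hc0 hletter
    exact absurd (pdLetter_eq_of_factor_eq (s := r + 4 * 2 ^ e) (e := e) (i := 8) (j := 20) h
      (by omega) (by omega) (by omega) (by omega)) (by decide +kernel)

theorem isGreatest_matchLengths_twelve_mul_sub_one (hy : y + r = 16 * 2 ^ e) (hr : 1 ≤ r)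
    (hr' : r < 3 * 2 ^ e) (hyE : y ∈ E) (hE : ∀ p ∈ E, p = y + 4 * 2 ^ e + 1 ∨ p ≤ y) :
    IsGreatest (matchLengths pdLetter E (y + 4 * 2 ^ e + 1)) (12 * 2 ^ e - 1) := by
  have hpow3 : 2 ^ (e + 2 + 1) = 8 * 2 ^ e := by ring
  have hpow4 : 2 ^ (e + 4) = 16 * 2 ^ e := by ring
  constructor
  · obtain ⟨x, hx⟩ : ∃ x, y + 1 = x + 12 * 2 ^ e := ⟨y + 1 - 12 * 2 ^ e, by omega⟩
    have hperiod := factor_pdLetter_add_two_pow_mul (d := e + 4) (x := x) (l := 12 * 2 ^ e - 1) 1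
      fun s hs hsl => Nat.not_dvd_of_pos_of_lt (by omega) (by omega)
    rw [mul_one, hpow4, show x + 16 * 2 ^ e = y + 4 * 2 ^ e + 1 by omega] at hperiod
    refine mem_matchLengths_iff.2 ⟨x, ?_, hperiod.symm⟩
    rwa [show x + (12 * 2 ^ e - 1) = y by omega]
  · intro l hl
    obtain ⟨x, hxE, h⟩ := mem_matchLengths_iff.1 hl
    by_contra! hlong
    have hsource := hE _ hxE
    obtain ⟨c, hc⟩ : 2 ^ (e + 2 + 1) ∣ x + (r + 4 * 2 ^ e - 1) :=
      (two_pow_dvd_add_iff_of_factor_pdLetter_eq (by omega) h _).2 ⟨3, by omega⟩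
    have hc2 : c < 2 := Nat.lt_of_mul_lt_mul_left (a := 2 ^ (e + 2 + 1)) (by omega)
    obtain rfl : c = 1 := by interval_cases c <;> omega
    exact absurd (pdLetter_eq_of_factor_eq (s := r + 12 * 2 ^ e - 1) (e := e) (i := 16) (j := 32) h
      (by omega) (by omega) (by omega) (by omega)) (by decide +kernel)

end PhraseLengths

section Cycles

variable {e t r y : ℕ} {L : List ℕ}

theorem lzEndChain_sixteen : LZEndChain pdLetter 16 [10, 7, 4, 2, 1, 0] := by
  have h0 : IsGreatest (matchLengths pdLetter [0] 0) 0 :=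
    isGreatest_matchLengths_iff.2 (by decide +kernel)
  have h1 : IsGreatest (matchLengths pdLetter [1, 0] 1) 0 :=
    isGreatest_matchLengths_iff.2 (by decide +kernel)
  have h2 : IsGreatest (matchLengths pdLetter [2, 1, 0] 2) 1 :=
    isGreatest_matchLengths_iff.2 (by decide +kernel)
  have h4 : IsGreatest (matchLengths pdLetter [4, 2, 1, 0] 4) 2 :=
    isGreatest_matchLengths_iff.2 (by decide +kernel)
  have h7 : IsGreatest (matchLengths pdLetter [7, 4, 2, 1, 0] 7) 2 :=
    isGreatest_matchLengths_iff.2 (by decide +kernel)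
  have h10 : IsGreatest (matchLengths pdLetter [10, 7, 4, 2, 1, 0] 10) 5 :=
    isGreatest_matchLengths_iff.2 (by decide +kernel)
  exact (((((LZEndChain.zero.step h0).step h1).step h2).step h4).step h7).step h10

/-- The start of the cycle of phrase lengths with index `e`: the infinite period-doubling word has
a phrase from `5 * 2 ^ e` to `8 * 2 ^ e`, the end of `periodDoubling (e + 3)`, and `L` lists the
earlier phrase boundaries. The boundary `4 * 2 ^ e - 1` is where the source of the last phrase of
`periodDoubling (e + t + 4)` ends as long as the cycle lasts. -/
structure IsCycleStart (e : ℕ) (L : List ℕ) : Prop where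
  chain : LZEndChain pdLetter (8 * 2 ^ e) (5 * 2 ^ e :: L)
  le : ∀ p ∈ L, p ≤ 5 * 2 ^ e
  mem : 4 * 2 ^ e - 1 ∈ L

/-- The state after `t` rounds of the cycle with index `e`: a phrase of the infinite
period-doubling word ends at `y`, which is `r` letters short of the end of
`periodDoubling (e + t + 4)`, and `L` lists the earlier phrase boundaries. -/
structure InCycle (e t r y : ℕ) (L : List ℕ) : Prop where
  chain : LZEndChain pdLetter y L
  round_add : t + 1 + r = 3 * 2 ^ e
  add_eq : y + r = 16 * 2 ^ (e + t)
  le : ∀ p ∈ L, p ≤ y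
  gap : ∀ p ∈ L, p + r ≤ 8 * 2 ^ (e + t) ∨ 8 * 2 ^ (e + t) ≤ p
  mem : 4 * 2 ^ e - 1 ∈ L

theorem lastPhraseKept_succ_iff {k : ℕ} {P : List (List Letter)} {q q' : List Letter}
    (h : lzEnd (periodDoubling k) = P ++ [q])
    (h' : P ++ [q'] <+: lzEnd (periodDoubling (k + 1))) :
    lastPhraseKept (k + 1) ↔ 4 ≤ k ∧ q' = q := by
  have hphrase : (lzEnd (periodDoubling (k + 1)))[P.length]? = some q' := by
    obtain ⟨Q, hQ⟩ := h'
    simp [← hQ]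
  simp [lastPhraseKept, lzEndCount, h, hphrase]

namespace InCycle

theorem remainder_lt (h : InCycle e t r y L) : r < 3 * 2 ^ (e + t) := by
  have hround := h.round_add
  have hle : 2 ^ e ≤ 2 ^ (e + t) := Nat.pow_le_pow_right two_pos (e.le_add_right t)
  omega

theorem chain_four_mul (h : InCycle e t r y L) (hr : 1 ≤ r) :
    LZEndChain pdLetter (y + 4 * 2 ^ (e + t) + 1) (y :: L) := by
  have hadd := h.add_eq
  have hlt := h.remainder_lt
  exact h.chain.step <| isGreatest_matchLengths_four_mul h.add_eq hr h.remainder_lt (by simp)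
    (List.forall_mem_cons.2 ⟨le_rfl, h.le⟩) (List.forall_mem_cons.2 ⟨by omega, h.gap⟩)

theorem chain_sixteen_mul (h : InCycle e t r y L) (hr : 1 ≤ r) :
    LZEndChain pdLetter (y + 16 * 2 ^ (e + t) + 1) ((y + 4 * 2 ^ (e + t) + 1) :: y :: L) := by
  have hpos : 0 < 2 ^ (e + t) := by positivity
  have hstep := (h.chain_four_mul hr).step <|
    isGreatest_matchLengths_twelve_mul_sub_one h.add_eq hr h.remainder_lt (by simp)
      (by simpa using fun p hp => .inr (h.le p hp))
  rwa [show y + 4 * 2 ^ (e + t) + 1 + (12 * 2 ^ (e + t) - 1) + 1 = y + 16 * 2 ^ (e + t) + 1 by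
    omega] at hstep

theorem succ (h : InCycle e t (r + 1) y L) :
    InCycle e (t + 1) r (y + 16 * 2 ^ (e + t) + 1) ((y + 4 * 2 ^ (e + t) + 1) :: y :: L) := by
  have hround := h.round_add
  have hadd := h.add_eq
  have hr := h.remainder_lt
  have hpow : 2 ^ (e + (t + 1)) = 2 * 2 ^ (e + t) := by rw [← add_assoc, pow_succ']
  refine ⟨h.chain_sixteen_mul (by omega), by omega, by omega, ?_, ?_, by simp [h.mem]⟩ <;>
    simp only [List.forall_mem_cons, hpow]
  · exact ⟨by omega, by omega, fun p hp => by have := h.le p hp; omega⟩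
  · exact ⟨by omega, by omega, fun p hp => by have := h.le p hp; omega⟩

theorem periodDoubling_eq (h : InCycle e t r y L) :
    periodDoubling (e + t + 4) = factor pdLetter 0 (y + r) := by
  rw [periodDoubling_eq_factor, h.add_eq, pow_add _ _ 4, mul_comm]
  rfl

theorem lzEnd_of_remainder_pos (h : InCycle e t r y L) (hr : 0 < r) :
    lzEnd (periodDoubling (e + t + 4)) = phrases pdLetter y L ++ [factor pdLetter y r] := by
  obtain ⟨l, rfl⟩ := Nat.exists_eq_add_one.2 hr
  have hround := h.round_add
  have hadd := h.add_eq
  have hle : 2 ^ e ≤ 2 ^ (e + t) := Nat.pow_le_pow_right two_pos (e.le_add_right t)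
  obtain ⟨x, hx⟩ : ∃ x, x + l + 1 = 4 * 2 ^ e := ⟨4 * 2 ^ e - 1 - l, by omega⟩
  have hpow : 2 ^ (e + 2) = 4 * 2 ^ e := by ring
  have hy : x + 2 ^ (e + 2) * (4 * 2 ^ t - 1) = y := by
    rw [Nat.mul_sub_one, show 2 ^ (e + 2) * (4 * 2 ^ t) = 16 * 2 ^ (e + t) by ring]
    omega
  have hperiod := factor_pdLetter_add_two_pow_mul (d := e + 2) (x := x) (l := l) (4 * 2 ^ t - 1)
    fun s hs hsl => Nat.not_dvd_of_pos_of_lt (by omega) (by omega)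
  rw [hy] at hperiod
  rw [h.periodDoubling_eq]
  refine h.chain.lzEnd_factor_add_succ (mem_matchLengths_iff.2 ⟨x, ?_, hperiod.symm⟩)
  rw [show x + l = 4 * 2 ^ e - 1 by omega]
  exact List.mem_cons_of_mem _ h.mem

theorem lzEnd_of_remainder_zero (h : InCycle e t 0 y L) :
    lzEnd (periodDoubling (e + t + 4)) = phrases pdLetter y L := by
  rw [h.periodDoubling_eq, add_zero, h.chain.lzEnd_factor]

theorem phrases_prefix_lzEnd (h : InCycle e t r y L) :
    phrases pdLetter y L <+: lzEnd (periodDoubling (e + t + 4)) := by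
  rcases r.eq_zero_or_pos with rfl | hr
  · rw [h.lzEnd_of_remainder_zero]
  · rw [h.lzEnd_of_remainder_pos hr]
    exact List.prefix_append _ _

theorem not_lastPhraseKept (h : InCycle e t r y L) (hr : 0 < r) :
    ¬lastPhraseKept (e + t + 5) := by
  obtain ⟨r, rfl⟩ := Nat.exists_eq_add_one.2 hr
  have hlt := h.remainder_lt
  have hprefix : phrases pdLetter y L ++ [factor pdLetter y (4 * 2 ^ (e + t) + 1)] <+:
      lzEnd (periodDoubling (e + t + 4 + 1)) := by
    rw [← phrases_add_succ]
    exact (List.prefix_append _ _).trans h.succ.phrases_prefix_lzEnd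
  rw [lastPhraseKept_succ_iff (h.lzEnd_of_remainder_pos hr) hprefix]
  rintro ⟨-, heq⟩
  have hlen := congrArg List.length heq
  simp only [length_factor] at hlen
  omega

end InCycle

namespace IsCycleStart

theorem inCycle (h : IsCycleStart e L) :
    InCycle e 0 (3 * 2 ^ e - 1) (8 * 2 ^ e + 5 * 2 ^ e + 1) (8 * 2 ^ e :: 5 * 2 ^ e :: L) := by
  have hpos : 0 < 2 ^ e := by positivity
  have hgreatest := isGreatest_matchLengths_five_mul (e := e) (E := 8 * 2 ^ e :: 5 * 2 ^ e :: L)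
    (by simp) (by simpa using fun p hp => .inr (h.le p hp))
  refine ⟨h.chain.step hgreatest, by omega, by rw [add_zero]; omega, ?_, ?_, by simp [h.mem]⟩ <;>
    simp only [List.forall_mem_cons, add_zero]
  · exact ⟨by omega, by omega, fun p hp => by have := h.le p hp; omega⟩
  · exact ⟨by omega, by omega, fun p hp => by have := h.le p hp; omega⟩

theorem exists_inCycle (h : IsCycleStart e L) (htr : t + 1 + r = 3 * 2 ^ e) :
    ∃ y L', InCycle e t r y L' ∧ L'.length = L.length + 2 + 2 * t := by
  induction t generalizing r with
  | zero =>
    obtain rfl : r = 3 * 2 ^ e - 1 := by omega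
    exact ⟨_, _, h.inCycle, rfl⟩
  | succ t ih =>
    obtain ⟨y, L', h', hlen⟩ := ih (r := r + 1) (by omega)
    exact ⟨_, _, h'.succ, by simp only [List.length_cons]; omega⟩

theorem next (h : IsCycleStart e L) :
    ∃ L', IsCycleStart (e + 3 * 2 ^ e) L' ∧ L'.length + 1 = L.length + 6 * 2 ^ e := by
  obtain ⟨t, ht⟩ : ∃ t, 3 * 2 ^ e = t + 2 := ⟨3 * 2 ^ e - 2, by grind [Nat.two_pow_pos e]⟩
  obtain ⟨y, L', h', hlen⟩ := h.exists_inCycle (t := t) (r := 1) (by omega)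
  have hadd := h'.add_eq
  have hpow : 2 ^ (e + 3 * 2 ^ e) = 4 * 2 ^ (e + t) := by rw [ht, ← add_assoc, pow_add]; ring
  refine ⟨y :: L', ⟨?_, ?_, ?_⟩, by simp only [List.length_cons]; omega⟩ <;> rw [hpow]
  · have hchain := h'.chain_sixteen_mul le_rfl
    rwa [show y + 16 * 2 ^ (e + t) + 1 = 8 * (4 * 2 ^ (e + t)) by omega,
      show y + 4 * 2 ^ (e + t) + 1 = 5 * (4 * 2 ^ (e + t)) by omega] at hchain
  · exact List.forall_mem_cons.2 ⟨by omega, fun p hp => by have := h'.le p hp; omega⟩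
  · exact List.mem_cons.2 (.inl (by omega))

theorem lzEnd_eq (h : IsCycleStart e L) :
    lzEnd (periodDoubling (e + 3)) = phrases pdLetter (8 * 2 ^ e) (5 * 2 ^ e :: L) := by
  rw [periodDoubling_eq_factor, show 2 ^ (e + 3) = 8 * 2 ^ e by ring, h.chain.lzEnd_factor]

theorem lastPhraseKept (h : IsCycleStart e L) (he : 1 ≤ e) : lastPhraseKept (e + 4) := by
  have hprefix : phrases pdLetter (8 * 2 ^ e) (5 * 2 ^ e :: L) <+:
      lzEnd (periodDoubling (e + 3 + 1)) :=
    (List.prefix_append _ _).trans h.inCycle.phrases_prefix_lzEnd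
  exact (lastPhraseKept_succ_iff h.lzEnd_eq hprefix).2 ⟨by omega, rfl⟩

end IsCycleStart

end Cycles

section CycleExp

/-- The indices `e` of the successive cycles (see `IsCycleStart`), so that
`k*_{i+1} = cycleExp i + 4`. -/
def cycleExp : ℕ → ℕ
  | 0 => 1
  | i + 1 => cycleExp i + 3 * 2 ^ cycleExp i

theorem cycleExp_strictMono : StrictMono cycleExp :=
  strictMono_nat_of_lt_succ fun _ => Nat.lt_add_of_pos_right (by positivity)

theorem one_le_cycleExp (i : ℕ) : 1 ≤ cycleExp i :=
  cycleExp_strictMono.monotone i.zero_le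

theorem exists_cycleExp_le_lt {n : ℕ} (hn : 1 ≤ n) :
    ∃ i, cycleExp i ≤ n ∧ n < cycleExp (i + 1) := by
  obtain ⟨i, hi, hi'⟩ := cycleExp_strictMono.exists_between_of_tendsto_atTop
    cycleExp_strictMono.tendsto_atTop (Nat.lt_add_one_of_le hn)
  exact ⟨i, Nat.le_of_lt_add_one hi, hi'⟩

theorem exists_isCycleStart_cycleExp (i : ℕ) :
    ∃ L, IsCycleStart (cycleExp i) L ∧ L.length + i = 2 * cycleExp i + 3 := by
  induction i with
  | zero => exact ⟨[7, 4, 2, 1, 0], ⟨lzEndChain_sixteen, by decide, by decide⟩, rfl⟩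
  | succ i ih =>
    obtain ⟨L, hL, hlen⟩ := ih
    obtain ⟨L', hL', hlen'⟩ := hL.next
    exact ⟨L', hL', by rw [cycleExp]; omega⟩

theorem lastPhraseKept_iff_exists_cycleExp {k : ℕ} :
    lastPhraseKept k ↔ ∃ i, cycleExp i + 4 = k := by
  constructor
  · intro hkept
    obtain ⟨n, rfl⟩ := Nat.exists_eq_add_of_le' hkept.1
    obtain ⟨i, hi, hi'⟩ := exists_cycleExp_le_lt (n := n + 1) (Nat.le_add_left 1 n)
    obtain hi | hi := hi.eq_or_lt
    · exact ⟨i, by omega⟩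
    obtain ⟨t, rfl⟩ := Nat.exists_eq_add_of_le (Nat.le_of_lt_add_one hi)
    obtain ⟨r, hr⟩ := Nat.exists_eq_add_of_lt hi'
    rw [cycleExp] at hr
    obtain ⟨L, hL, -⟩ := exists_isCycleStart_cycleExp i
    obtain ⟨y, L', h, -⟩ := hL.exists_inCycle (t := t) (r := r + 1) (by omega)
    exact absurd hkept (h.not_lastPhraseKept r.succ_pos)
  · rintro ⟨i, rfl⟩
    obtain ⟨L, hL, -⟩ := exists_isCycleStart_cycleExp i
    exact hL.lastPhraseKept (one_le_cycleExp i)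

theorem kStar_succ (i : ℕ) : kStar (i + 1) = cycleExp i + 4 := by
  have hmono : StrictMono fun i => cycleExp i + 4 := cycleExp_strictMono.add_const 4
  have hkept (i : ℕ) : lastPhraseKept (cycleExp i + 4) :=
    lastPhraseKept_iff_exists_cycleExp.2 ⟨i, rfl⟩
  have hinfinite : {k | lastPhraseKept k}.Infinite :=
    (Set.infinite_range_of_injective hmono.injective).mono (Set.range_subset_iff.2 hkept)
  have hnth := Nat.nth_comp_of_strictMono (p := lastPhraseKept) (n := i) hmono
    (fun k hk => lastPhraseKept_iff_exists_cycleExp.1 hk) fun hfin => absurd hfin hinfinite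
  rw [kStar, Nat.add_sub_cancel, ← hnth, Nat.nth_of_forall fun j _ => hkept j]

theorem lzEndCount_periodDoubling {i k : ℕ} (hi : cycleExp i + 3 ≤ k)
    (hi' : k < cycleExp (i + 1) + 3) : lzEndCount (periodDoubling k) + (i + 2) = 2 * k := by
  obtain ⟨L, hL, hlen⟩ := exists_isCycleStart_cycleExp i
  obtain rfl | hlt := hi.eq_or_lt
  · rw [lzEndCount, hL.lzEnd_eq, length_phrases, List.length_cons]
    omega
  · obtain ⟨t, rfl⟩ := Nat.exists_eq_add_of_le hlt
    obtain ⟨r, hr⟩ := Nat.exists_eq_add_of_lt hi'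
    rw [cycleExp] at hr
    obtain ⟨y, L', h, hlen'⟩ := hL.exists_inCycle (t := t) (r := r + 1) (by omega)
    rw [lzEndCount, show cycleExp i + 3 + 1 + t = cycleExp i + t + 4 by omega,
      h.lzEnd_of_remainder_pos r.succ_pos, List.length_append, length_phrases,
      List.length_singleton]
    omega

end CycleExp

section LogStar

theorem logStar_of_one_lt {x : ℝ} (hx : 1 < x) : logStar x = logStar (Real.logb 2 x) + 1 := by
  classical
  exact Nat.find_comp_succ _ _ hx.not_ge

theorem le_logStar_of_cycleExp_le {i : ℕ} {x : ℝ} (hx : cycleExp i ≤ x) : i ≤ logStar x := by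
  induction i generalizing x with
  | zero => exact Nat.zero_le _
  | succ i ih =>
    have hpow : (2 : ℝ) ^ cycleExp i ≤ x := by
      refine le_trans ?_ hx
      exact_mod_cast (by rw [cycleExp]; omega : 2 ^ cycleExp i ≤ cycleExp (i + 1))
    have hexp : cycleExp i ≠ 0 := Nat.one_le_iff_ne_zero.1 (one_le_cycleExp i)
    have hone : 1 < x := (one_lt_pow₀ one_lt_two hexp).trans_le hpow
    have hlog : (cycleExp i : ℝ) ≤ Real.logb 2 x := by
      rwa [Real.le_logb_iff_rpow_le one_lt_two (by positivity), Real.rpow_natCast]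
    rw [logStar_of_one_lt hone]
    exact Nat.add_le_add_right (ih hlog) 1

theorem isBigO_two_mul_sub_lzEndCount_logStar :
    (fun k : ℕ => (2 * k - lzEndCount (periodDoubling k) : ℝ)) =O[atTop]
      fun k : ℕ => (logStar k : ℝ) := by
  refine IsBigO.of_bound 3 ?_
  filter_upwards [eventually_ge_atTop 4] with k hk
  obtain ⟨n, rfl⟩ := Nat.exists_eq_add_of_le' hk
  obtain ⟨i, hi, hi'⟩ := exists_cycleExp_le_lt (n := n + 1) (Nat.le_add_left 1 n)
  have hcount : (lzEndCount (periodDoubling (n + 4)) + (i + 2) : ℝ) = 2 * (n + 4 : ℕ) := by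
    exact_mod_cast lzEndCount_periodDoubling (i := i) (k := n + 4) (by omega) (by omega)
  have hi_le : (i : ℝ) ≤ logStar (n + 4 : ℕ) := by
    exact_mod_cast le_logStar_of_cycleExp_le (x := (n + 4 : ℕ))
      (by exact_mod_cast (by omega : cycleExp i ≤ n + 4))
  have hone_le : (1 : ℝ) ≤ logStar (n + 4 : ℕ) := by
    rw [logStar_of_one_lt (by exact_mod_cast (by omega : 1 < n + 4))]
    exact_mod_cast Nat.le_add_left 1 _
  rw [← hcount, add_sub_cancel_left, Real.norm_of_nonneg (by positivity),
    Real.norm_of_nonneg (by positivity)]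
  linarith

end LogStar

theorem theorem1 :
    ∃ f : ℕ → ℤ,
      (∀ k : ℕ, (lzEndCount (periodDoubling k) : ℤ) = 2 * (k : ℤ) - f k) ∧
      (fun k : ℕ => (f k : ℝ)) =O[atTop] (fun k : ℕ => (logStar (k : ℝ) : ℝ)) ∧
      (∀ k m : ℕ, 5 ≤ k → 1 ≤ m →
        (kStar m : ℤ) - 1 ≤ (k : ℤ) → (k : ℤ) ≤ (kStar (m + 1) : ℤ) - 2 → f k = (m : ℤ) + 1) ∧
      kStar 1 = 5 ∧
      (∀ m : ℕ, 2 ≤ m →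
        (kStar m : ℝ) = (kStar (m - 1) : ℝ) + 3 / 16 * (2 : ℝ) ^ kStar (m - 1)) := by
  refine ⟨fun k => 2 * k - lzEndCount (periodDoubling k), fun k => by ring,
    by exact_mod_cast isBigO_two_mul_sub_lzEndCount_logStar, ?_, kStar_succ 0, ?_⟩
  · intro k m _ hm hk hk'
    obtain ⟨i, rfl⟩ := Nat.exists_eq_add_of_le' hm
    rw [kStar_succ] at hk hk'
    have hcount := lzEndCount_periodDoubling (i := i) (k := k) (by omega) (by omega)
    push_cast
    omega
  · intro m hm
    obtain ⟨i, rfl⟩ := Nat.exists_eq_add_of_le' hm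
    rw [show i + 2 - 1 = i + 1 from rfl, kStar_succ, kStar_succ, cycleExp]
    push_cast
    ring
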